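/- Let $k>1$, let $\mathbb{T}^k=(\mathbb{R}/\mathbb{Z})^k$ with normalized Lebesgue measure $\mathrm{Leb}$, and let $v\in\mathbb{T}^k$ be a vector whose components together with $1$ are linearly independent over $\mathbb{Q}$. Let $A\subset\mathbb{T}^k$ be a Borel set, put $\varphi_A(\varepsilon)=\mathrm{Leb}\bigl(A\,\Delta\,(A+\varepsilon)\bigr)$ for $\varepsilon\in\mathbb{T}^k$, and assume that $A$ has no translational symmetries, i.e. $\varphi_A(\varepsilon)=0$ if and only if $\varepsilon=0$. Let $f(x)=x+v$ for $x\in A$ and $f(x)=x$ for $x\notin A$. For $w=(w_1,w_2,\dots)\in\Omega=(\mathbb{T}^k)^{\mathbb{N}}$, where $\Omega$ carries the product measure $\mathrm{Leb}^{\mathbb{N}}$, put $F_w^n=f_{w_n}\circ\dots\circ f_{w_1}$ with $f_u(x)=f(x)+u$. Then: 1. There is $\alpha>0$ such that $\varphi_A(u)\ge\alpha\,\mathrm{dist}(u,0)$ for all $u\in\mathbb{T}^k$, where $\mathrm{dist}$ is the maximum over the coordinates of the distances on $\mathbb{R}/\mathbb{Z}$. 2. $Z:=\int_{\mathbb{T}^k}\frac{dx}{\varphi_A(x)}<\infty$,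 and $\overline{\mu}:=\frac1Z\cdot\frac{dx}{\varphi_A(x)}$ is a probability measure. 3. For Lebesgue-almost every $(x,y)\in\mathbb{T}^k\times\mathbb{T}^k$ and almost every $w\in\Omega$, one has the weak convergence of measures $$\frac1N\sum_{n=1}^N\delta_{F_w^n(x)-F_w^n(y)}\longrightarrow\overline{\mu}\qquad(N\to\infty);$$ in particular the limit $\overline\mu$ does not depend on $w$. 4. Consequently there is no synchronization: for Lebesgue-almost every $(x,y)$ and almost every $w$, it is not true that for every $\delta>0$ $$\frac1N\,\#\{n\in\{1,\dots,N\}\mid \mathrm{dist}(F_w^n(x),F_w^n(y))<\delta\}\longrightarrow 1\qquad(N\to\infty).$$ -/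

import Mathlib

open MeasureTheory Filter Topology
open scoped NNReal ENNReal

namespace DoubleRotation

/-- The torus `𝕋^k = (ℝ/ℤ)^k`. Its `volume` is the Lebesgue measure of total mass one, and its
`dist` is the maximum over the coordinates of the distances on the circle `ℝ/ℤ`. -/
abbrev Torus (k : ℕ) : Type := UnitAddTorus (Fin k)

/-- The Lebesgue measure of the circle `ℝ/ℤ` is a probability measure. -/
instance isProbabilityMeasure_unitAddCircle :
    IsProbabilityMeasure (volume : Measure UnitAddCircle) :=
  ⟨UnitAddCircle.measure_univ⟩

/-- The components of `v`, together with `1`, are linearly independent over `ℚ`. (Changing the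
real representatives of the components by integers does not affect this.) -/
def RationallyIndependent {k : ℕ} (v : Torus k) : Prop :=
  ∃ a : Fin k → ℝ, (∀ i, (a i : UnitAddCircle) = v i) ∧
    LinearIndependent ℚ (Fin.cons 1 a : Fin (k + 1) → ℝ)

/-- The displacement function `φ_A(ε) = Leb (A ∆ T_ε(A))`. -/
noncomputable def displacement {k : ℕ} (A : Set (Torus k)) (ε : Torus k) : ℝ :=
  (volume (symmDiff A ((fun x => x + ε) '' A))).toReal

/-- `A` has no translational symmetries: `φ_A(ε) = 0` if and only if `ε = 0`. -/
def NoTranslationalSymmetries {k : ℕ} (A : Set (Torus k)) : Prop :=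
  ∀ ε : Torus k, displacement A ε = 0 ↔ ε = 0

open Classical in
/-- The double rotation: `f(x) = x + v` for `x ∈ A`, and `f(x) = x` for `x ∉ A`. -/
noncomputable def doubleRotation {k : ℕ} (A : Set (Torus k)) (v x : Torus k) : Torus k :=
  if x ∈ A then x + v else x

/-- The random iterations `F_w^n = f_{w_n} ∘ ⋯ ∘ f_{w_1}`, where `f_u(x) = f(x) + u`.
The sequence `w_1, w_2, …` is given as `w 0, w 1, …`. -/
noncomputable def randomIterate {k : ℕ} (A : Set (Torus k)) (v : Torus k) (w : ℕ → Torus k) :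
    ℕ → Torus k → Torus k
  | 0, x => x
  | n + 1, x => doubleRotation A v (randomIterate A v w n x) + w n

/-- The probability measure `Leb^ℕ` on the space `Ω = (𝕋^k)^ℕ` of sequences. -/
noncomputable def noise (k : ℕ) : Measure (ℕ → Torus k) :=
  Measure.infinitePi (fun _ : ℕ => (volume : Measure (Torus k)))

/-- The unit point mass at `z`. -/
noncomputable def pointMass {k : ℕ} (z : Torus k) : FiniteMeasure (Torus k) :=
  ⟨Measure.dirac z, inferInstance⟩

/-- The empirical distribution `(1/N) ∑_{n=1}^N δ_{F_w^n(x) - F_w^n(y)}` of the differences. -/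
noncomputable def empiricalDifference {k : ℕ} (A : Set (Torus k)) (v : Torus k)
    (w : ℕ → Torus k) (x y : Torus k) (N : ℕ) : FiniteMeasure (Torus k) :=
  (N : ℝ≥0)⁻¹ • ∑ n ∈ Finset.Icc 1 N,
    pointMass (randomIterate A v w n x - randomIterate A v w n y)

/-- `1/φ_A`, with values in `[0, ∞]` (so `1/0 = ∞`). -/
noncomputable def inverseDisplacement {k : ℕ} (A : Set (Torus k)) (u : Torus k) : ℝ≥0∞ :=
  (ENNReal.ofReal (displacement A u))⁻¹

/-- `Z = ∫ dx / φ_A(x)`, with values in `[0, ∞]`. -/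
noncomputable def totalMass {k : ℕ} (A : Set (Torus k)) : ℝ≥0∞ :=
  ∫⁻ u, inverseDisplacement A u

/-- The measure `(1/Z) dx / φ_A(x)`. -/
noncomputable def limitMeasure {k : ℕ} (A : Set (Torus k)) : Measure (Torus k) :=
  (totalMass A)⁻¹ • (volume : Measure (Torus k)).withDensity (inverseDisplacement A)

open Classical in
/-- The orbits of `x` and `y` synchronize along `w`: for every `δ > 0`, the proportion of the times
`n ∈ {1, …, N}` with `dist (F_w^n(x), F_w^n(y)) < δ` tends to `1` as `N → ∞`. -/
def Synchronize {k : ℕ} (A : Set (Torus k)) (v : Torus k) (w : ℕ → Torus k)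
    (x y : Torus k) : Prop :=
  ∀ δ : ℝ, 0 < δ → Tendsto
    (fun N : ℕ => (((Finset.Icc 1 N).filter
      (fun n => dist (randomIterate A v w n x) (randomIterate A v w n y) < δ)).card : ℝ) / (N : ℝ))
    atTop (𝓝 1)

end DoubleRotation

/-! Two points driven by the same noise form a Markov chain. The uniform noise makes the first point
uniform and independent of the difference, so the difference `z` is itself a Markov chain: it stays
with probability `1 - φ_A(z)` and moves to `z + v` or `z - v` with probability `φ_A(z)/2` each
(`lintegral_comp_doubleRotation_sub`). The density `1/φ_A` cancels the jump rate and leaves a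
symmetric walk, which preserves Lebesgue measure; hence `dz/φ_A(z)` is stationary. It is finite
because `φ_A(2u) ≤ 2 φ_A(u)` and compactness give `φ_A(u) ≥ α‖u‖`, while `1/‖u‖` is integrable when
`k ≥ 2`.

A bounded harmonic function of the difference chain satisfies `2γ(z) = γ(z + v) + γ(z - v)` almost
everywhere. By irrationality of `v`, all its nontrivial Fourier coefficients vanish, so it is
constant (`ae_eq_const_of_harmonic`). This makes the skew product over the shift of the noise
ergodic (`ergodic_skewProduct`), and Birkhoff's theorem gives the time averages. Lebesgue measure is
absolutely continuous with respect to the stationary measure since `1/φ_A ≥ 1`, so the averages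
converge from Lebesgue-almost every pair. Synchronization fails because the limit measure charges
the complement of a small ball. -/

/-! ### Birkhoff's theorem for bounded functions, via the maximal inequality. -/

section PointwiseErgodic

variable {α : Type*}

/-- The largest of the Birkhoff sums of length at most `N`. -/
noncomputable def maxBirkhoffSum (T : α → α) (g : α → ℝ) : ℕ → α → ℝ
  | 0, _ => 0
  | N + 1, x => max 0 (g x + maxBirkhoffSum T g N (T x))

variable {T : α → α} {g : α → ℝ}

theorem maxBirkhoffSum_nonneg (N : ℕ) (x : α) : 0 ≤ maxBirkhoffSum T g N x := by
  cases N <;> simp [maxBirkhoffSum]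

theorem maxBirkhoffSum_le_succ (N : ℕ) (x : α) :
    maxBirkhoffSum T g N x ≤ maxBirkhoffSum T g (N + 1) x := by
  induction N generalizing x with
  | zero => exact maxBirkhoffSum_nonneg 1 x
  | succ N ih =>
    rw [maxBirkhoffSum, maxBirkhoffSum]
    exact max_le_max le_rfl (by linarith [ih (T x)])

theorem birkhoffSum_le_maxBirkhoffSum (N : ℕ) (x : α) :
    birkhoffSum T g N x ≤ maxBirkhoffSum T g N x := by
  induction N generalizing x with
  | zero => simp [maxBirkhoffSum]
  | succ N ih =>
    rw [birkhoffSum_succ', maxBirkhoffSum]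
    exact le_max_of_le_right (by linarith [ih (T x)])

variable [MeasurableSpace α] {μ : Measure α}

theorem integrable_maxBirkhoffSum (hT : MeasurePreserving T μ μ) (hg : Integrable g μ) (N : ℕ) :
    Integrable (maxBirkhoffSum T g N) μ := by
  induction N with
  | zero => exact integrable_zero _ _ _
  | succ N ih => exact (integrable_zero _ _ _).sup (hg.add (hT.integrable_comp_of_integrable ih))

theorem measurable_maxBirkhoffSum (hT : Measurable T) (hg : Measurable g) (N : ℕ) :
    Measurable (maxBirkhoffSum T g N) := by
  induction N with
  | zero => exact measurable_const
  | succ N ih => exact measurable_const.max (hg.add (ih.comp hT))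

/-- The maximal ergodic inequality, for a fixed horizon. -/
theorem setIntegral_maxBirkhoffSum_pos_nonneg (hT : MeasurePreserving T μ μ)
    (hg : Integrable g μ) (hgm : Measurable g) (N : ℕ) :
    0 ≤ ∫ x in {x | 0 < maxBirkhoffSum T g N x}, g x ∂μ := by
  set M := maxBirkhoffSum T g N with hM
  have hMi : Integrable M μ := integrable_maxBirkhoffSum hT hg N
  have hMT : Integrable (fun x => M (T x)) μ := hT.integrable_comp_of_integrable hMi
  have hMm : Measurable M := measurable_maxBirkhoffSum hT.measurable hgm N
  have hs : MeasurableSet {x | 0 < M x} := measurableSet_lt measurable_const hMm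
  have hint : ∫ x, M (T x) ∂μ = ∫ x, M x ∂μ := by
    conv_rhs => rw [← hT.map_eq]
    exact (integral_map hT.aemeasurable hMm.aestronglyMeasurable).symm
  -- Garsia's argument: where `M > 0`, the recursion for the next horizon gives `M ≤ g + M ∘ T`; the
  -- integral of `M - M ∘ T` over this set is nonnegative by invariance of `μ`.
  have h1 : ∫ x in {x | 0 < M x}, (M x - M (T x)) ∂μ ≤ ∫ x in {x | 0 < M x}, g x ∂μ := by
    refine setIntegral_mono_on (hMi.sub hMT).integrableOn hg.integrableOn hs fun x hx => ?_
    have h := maxBirkhoffSum_le_succ (T := T) (g := g) N x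
    have hx' : 0 < M x := hx
    rw [maxBirkhoffSum] at h
    rcases le_max_iff.1 h with h | h
    · exact absurd h (not_le.2 hx')
    · simp only [hM]; linarith
  have h2 : ∫ x in {x | 0 < M x}, M x ∂μ = ∫ x, M x ∂μ := by
    refine setIntegral_eq_integral_of_forall_compl_eq_zero fun x hx => ?_
    exact le_antisymm (not_lt.1 hx) (maxBirkhoffSum_nonneg N x)
  have h3 : ∫ x in {x | 0 < M x}, M (T x) ∂μ ≤ ∫ x, M (T x) ∂μ :=
    setIntegral_le_integral hMT (ae_of_all _ fun x => maxBirkhoffSum_nonneg N (T x))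
  rw [integral_sub hMi.integrableOn hMT.integrableOn] at h1
  linarith

/-- If almost every orbit has a positive Birkhoff sum then the integral is nonnegative. -/
theorem integral_nonneg_of_ae_exists_birkhoffSum_pos (hT : MeasurePreserving T μ μ)
    (hg : Integrable g μ) (hgm : Measurable g)
    (h : ∀ᵐ x ∂μ, ∃ n, 0 < birkhoffSum T g n x) : 0 ≤ ∫ x, g x ∂μ := by
  have hmono : Monotone fun N => {x | 0 < maxBirkhoffSum T g N x} :=
    monotone_nat_of_le_succ fun N x hx => lt_of_lt_of_le hx (maxBirkhoffSum_le_succ N x)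
  have hlim := tendsto_setIntegral_of_monotone (μ := μ) (f := g)
    (fun N => measurableSet_lt measurable_const
      (measurable_maxBirkhoffSum hT.measurable hgm N)) hmono hg.integrableOn
  have huniv : (⋃ N, {x | 0 < maxBirkhoffSum T g N x}) =ᵐ[μ] Set.univ := by
    rw [eventuallyEq_univ]
    filter_upwards [h] with x hx
    obtain ⟨n, hn⟩ := hx
    exact Set.mem_iUnion.2 ⟨n, hn.trans_le (birkhoffSum_le_maxBirkhoffSum n x)⟩
  rw [setIntegral_congr_set huniv, setIntegral_univ] at hlim
  exact ge_of_tendsto' hlim fun N => setIntegral_maxBirkhoffSum_pos_nonneg hT hg hgm N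

theorem measurable_birkhoffAverage (hT : Measurable T) (hgm : Measurable g) (n : ℕ) :
    Measurable (birkhoffAverage ℝ T g n) := by
  unfold birkhoffAverage birkhoffSum
  exact Measurable.const_smul (Finset.measurable_sum _ fun k _ => hgm.comp (hT.iterate k))
    ((n : ℝ)⁻¹)

/-- The good set `B` is invariant, hence null or conull. If it were null, almost every orbit would
have an average above `a`, so `g - a` would have a positive Birkhoff sum, and the maximal inequality
would contradict `∫ g < a`. Rational thresholds keep `B` measurable. -/
theorem Ergodic.ae_eventually_birkhoffAverage_le [IsProbabilityMeasure μ] (hT : Ergodic T μ)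
    (hgm : Measurable g) {C : ℝ} (hC : ∀ x, |g x| ≤ C) {a : ℝ} (ha : ∫ x, g x ∂μ < a) :
    ∀ᵐ x ∂μ, ∀ r : ℚ, a < r → ∀ᶠ n in atTop, birkhoffAverage ℝ T g n x ≤ r := by
  have hgi : Integrable g μ :=
    .of_bound hgm.aestronglyMeasurable C (ae_of_all _ hC)
  set B : Set α := {x | ∀ r : ℚ, a < r → ∀ᶠ n in atTop, birkhoffAverage ℝ T g n x ≤ r} with hB
  have hBm : MeasurableSet B := by
    have : B = ⋂ (r : ℚ) (_ : a < r), ⋃ N : ℕ, ⋂ (n : ℕ) (_ : N ≤ n),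
        {x | birkhoffAverage ℝ T g n x ≤ r} := by
      ext x; simp [hB, eventually_atTop]
    rw [this]
    exact .iInter fun r => .iInter fun _ => .iUnion fun N => .iInter fun n => .iInter fun _ =>
      measurableSet_le (measurable_birkhoffAverage hT.measurable hgm n) measurable_const
  have hdiff (x : α) : Tendsto (fun n => birkhoffAverage ℝ T g n (T x) - birkhoffAverage ℝ T g n x)
      atTop (𝓝 0) := by
    refine tendsto_birkhoffAverage_apply_sub_birkhoffAverage ℝ ?_
    refine (Metric.isBounded_closedBall (x := (0 : ℝ)) (r := C)).subset ?_
    rintro _ ⟨n, rfl⟩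
    simpa using hC _
  -- The slack between `a` and `r` absorbs a perturbation tending to zero; this is what makes `B`
  -- invariant.
  have key (u w : ℕ → ℝ) (huw : Tendsto (fun n => u n - w n) atTop (𝓝 0))
      (hw : ∀ r : ℚ, a < r → ∀ᶠ n in atTop, w n ≤ r) (r : ℚ) (hr : a < r) :
      ∀ᶠ n in atTop, u n ≤ r := by
    obtain ⟨q, hq1, hq2⟩ := exists_rat_btwn hr
    have hq : (0 : ℝ) < r - q := sub_pos.2 hq2
    filter_upwards [hw q hq1, huw.eventually_lt_const hq] with n h1 h2
    linarith
  have hinv : T ⁻¹' B = B := by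
    ext x
    constructor
    · exact fun hx => key _ _ (by simpa using (hdiff x).neg) hx
    · exact fun hx => key _ _ (hdiff x) hx
  rcases hT.toPreErgodic.ae_mem_or_ae_notMem hBm hinv with h | h
  · exact h
  · exfalso
    have hpos : 0 ≤ ∫ x, (g x - a) ∂μ := by
      refine integral_nonneg_of_ae_exists_birkhoffSum_pos hT.toMeasurePreserving
        (hgi.sub (integrable_const a)) (hgm.sub_const a) ?_
      filter_upwards [h] with x hx
      simp only [hB, Set.mem_ofPred_eq, not_forall, not_eventually, not_le] at hx
      obtain ⟨r, hr, hfr⟩ := hx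
      obtain ⟨n, hn1, hn⟩ := (hfr.and_eventually (eventually_ge_atTop 1)).exists
      refine ⟨n, ?_⟩
      have hn0 : (0 : ℝ) < n := by exact_mod_cast hn
      simp only [birkhoffAverage, smul_eq_mul, birkhoffSum] at hn1
      simp only [birkhoffSum, Finset.sum_sub_distrib, Finset.sum_const, Finset.card_range,
        nsmul_eq_mul]
      have h2 := hr.trans hn1
      rw [inv_mul_eq_div, lt_div_iff₀ hn0] at h2
      linarith
    rw [integral_sub hgi (integrable_const a)] at hpos
    simp at hpos
    linarith

/-- Birkhoff's pointwise ergodic theorem for bounded functions and ergodic maps. -/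
theorem Ergodic.ae_tendsto_birkhoffAverage [IsProbabilityMeasure μ] (hT : Ergodic T μ)
    (hgm : Measurable g) {C : ℝ} (hC : ∀ x, |g x| ≤ C) :
    ∀ᵐ x ∂μ, Tendsto (fun n => birkhoffAverage ℝ T g n x) atTop (𝓝 (∫ x, g x ∂μ)) := by
  have upper (f : α → ℝ) (hfm : Measurable f) (hfC : ∀ x, |f x| ≤ C) :
      ∀ᵐ x ∂μ, ∀ b, ∫ x, f x ∂μ < b → ∀ᶠ n in atTop, birkhoffAverage ℝ T f n x < b := by
    have h : ∀ᵐ x ∂μ, ∀ a : ℚ, ∫ x, f x ∂μ < a → ∀ r : ℚ, (a : ℝ) < r →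
        ∀ᶠ n in atTop, birkhoffAverage ℝ T f n x ≤ r := by
      rw [ae_all_iff]
      intro a
      by_cases ha : ∫ x, f x ∂μ < a
      · filter_upwards [hT.ae_eventually_birkhoffAverage_le hfm hfC ha] with x hx _ using hx
      · exact ae_of_all _ fun x h => absurd h ha
    filter_upwards [h] with x hx b hb
    obtain ⟨r, hr1, hr2⟩ := exists_rat_btwn hb
    obtain ⟨a, ha1, ha2⟩ := exists_rat_btwn hr1
    filter_upwards [hx a ha1 r ha2] with n hn using hn.trans_lt hr2
  filter_upwards [upper g hgm hC, upper (fun x => -g x) hgm.neg (by simpa using hC)] with x h1 h2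
  refine tendsto_order.2 ⟨fun b hb => ?_, fun b hb => h1 b hb⟩
  have h3 := h2 (-b) (by rw [integral_neg]; linarith)
  filter_upwards [h3] with n hn
  simp only [birkhoffAverage, birkhoffSum, Finset.sum_neg_distrib, smul_eq_mul, mul_neg] at hn ⊢
  linarith

end PointwiseErgodic

/-! ### Ergodicity of skew products over the shift of the noise. -/

section SkewProduct

variable {E W : Type*} [MeasurableSpace E] [MeasurableSpace W]

/-- Prepend a term to a sequence. -/
def seqCons (p : W × (ℕ → W)) : ℕ → W
  | 0 => p.1
  | n + 1 => p.2 n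

theorem measurable_seqCons : Measurable (seqCons (W := W)) := by
  refine measurable_pi_lambda _ fun n => ?_
  cases n with
  | zero => exact measurable_fst
  | succ n => exact (measurable_pi_apply n).comp measurable_snd

/-- An i.i.d. sequence is its head together with an independent tail of the same law. It suffices to
check cylinders, padded with `Set.univ` to an initial segment of coordinates. -/
theorem measurePreserving_seqCons (ν : Measure W) [IsProbabilityMeasure ν] :
    MeasurePreserving seqCons (ν.prod (Measure.infinitePi fun _ : ℕ => ν))
      (Measure.infinitePi fun _ : ℕ => ν) := by
  refine ⟨measurable_seqCons, Measure.eq_infinitePi _ fun s t ht => ?_⟩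
  obtain ⟨n, hn⟩ := s.exists_nat_subset_range
  have hn' : s ⊆ Finset.range (n + 1) := hn.trans (Finset.range_mono n.le_succ)
  set t' : ℕ → Set W := fun i => if i ∈ s then t i else Set.univ with ht'
  have hm (i : ℕ) : MeasurableSet (t' i) := by
    simp only [ht']; split_ifs
    exacts [ht i, .univ]
  have h1 : ∏ i ∈ s, ν (t i) = ∏ i ∈ Finset.range (n + 1), ν (t' i) := by
    rw [← Finset.prod_subset hn' fun i _ hi => by simp [ht', hi]]
    exact Finset.prod_congr rfl fun i hi => by simp [ht', hi]
  have h2 : seqCons ⁻¹' (Set.pi s t) =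
      t' 0 ×ˢ Set.pi (Finset.range n) (fun i => t' (i + 1)) := by
    ext p
    simp only [Set.mem_preimage, Set.mem_pi, Finset.mem_coe, Set.mem_prod, Finset.mem_range]
    constructor
    · refine fun h => ⟨?_, fun i _ => ?_⟩
      · by_cases h0 : 0 ∈ s
        · simpa [ht', h0, seqCons] using h 0 h0
        · simp [ht', h0]
      · by_cases h0 : i + 1 ∈ s
        · simpa [ht', h0, seqCons] using h _ h0
        · simp [ht', h0]
    · rintro ⟨h0, h⟩ i hi
      cases i with
      | zero => simpa [ht', hi, seqCons] using h0
      | succ i => simpa [ht', hi, seqCons] using h i (by simpa using hn' hi)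
  rw [Measure.map_apply measurable_seqCons (.pi s.countable_toSet fun i _ => ht i), h2,
    Measure.prod_prod, Measure.infinitePi_pi _ fun i _ => hm _, h1, Finset.prod_range_succ',
    mul_comm]

/-- The skew product of the full shift with a random map. -/
def skewProduct (κ : E × W → E) (p : E × (ℕ → W)) : E × (ℕ → W) :=
  (κ (p.1, p.2 0), fun n => p.2 (n + 1))

theorem measurable_skewProduct {κ : E × W → E} (hκ : Measurable κ) :
    Measurable (skewProduct κ) := by
  unfold skewProduct; fun_prop

theorem measurePreserving_skewProduct {κ : E × W → E} {m : Measure E} [IsProbabilityMeasure m]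
    {ν : Measure W} [IsProbabilityMeasure ν] (hκ : MeasurePreserving κ (m.prod ν) m) :
    MeasurePreserving (skewProduct κ) (m.prod (Measure.infinitePi fun _ : ℕ => ν))
      (m.prod (Measure.infinitePi fun _ : ℕ => ν)) := by
  set P := Measure.infinitePi fun _ : ℕ => ν
  have h1 : MeasurePreserving (Prod.map id seqCons) (m.prod (ν.prod P)) (m.prod P) :=
    (MeasurePreserving.id m).prod (measurePreserving_seqCons ν)
  have h2 : MeasurePreserving (Prod.map κ id) ((m.prod ν).prod P) (m.prod P) :=
    hκ.prod (MeasurePreserving.id P)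
  have h3 := h2.comp (measurePreserving_prodAssoc m ν P).symm
  refine ⟨measurable_skewProduct hκ.measurable, ?_⟩
  conv_lhs => rw [← h1.map_eq]
  rw [Measure.map_map (measurable_skewProduct hκ.measurable) h1.measurable]
  exact h3.map_eq

/-- A random map all of whose bounded harmonic functions are constant has an ergodic
skew product. -/
theorem ergodic_skewProduct {κ : E × W → E} {m : Measure E} [IsProbabilityMeasure m]
    {ν : Measure W} [IsProbabilityMeasure ν] (hκ : MeasurePreserving κ (m.prod ν) m)
    (hharm : ∀ h : E → ℝ≥0∞, Measurable h → (∀ e, h e ≤ 1) →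
      (∀ e, h e = ∫⁻ a, h (κ (e, a)) ∂ν) → ∃ c, ∀ᵐ e ∂m, h e = c) :
    Ergodic (skewProduct κ) (m.prod (Measure.infinitePi fun _ : ℕ => ν)) := by
  classical
  set P := Measure.infinitePi fun _ : ℕ => ν with hP
  refine { measurePreserving_skewProduct hκ with aeconst_set := fun B hB hinv => ?_ }
  have hsec (e : E) : MeasurableSet {w | (e, w) ∈ B} := measurable_prodMk_left hB
  -- Condition on the first noise term `a`: by invariance, `(e, seqCons (a, w))` lies in `B` exactly
  -- when `(κ (e, a), w)` does.
  have hstep (e : E) (C : Set (ℕ → W)) (hC : MeasurableSet C) :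
      P ({w | (e, w) ∈ B} ∩ C) =
        ∫⁻ a, P ({w | (κ (e, a), w) ∈ B} ∩ {w | seqCons (a, w) ∈ C}) ∂ν := by
    have hmp := measurePreserving_seqCons ν
    rw [← hP] at hmp
    rw [← hmp.measure_preimage ((hsec e).inter hC).nullMeasurableSet,
      Measure.prod_apply (measurable_seqCons ((hsec e).inter hC))]
    refine lintegral_congr fun a => congrArg P ?_
    ext w
    have : (e, seqCons (a, w)) ∈ B ↔ (κ (e, a), w) ∈ B := by
      conv_lhs => rw [← hinv]
      rfl
    simp [this]
  -- With no constraint on the noise, `hstep` says that the measure of the section is harmonic.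
  obtain ⟨c, hc⟩ := hharm (fun e => P {w | (e, w) ∈ B}) (measurable_measure_prodMk_left hB)
    (fun e => prob_le_one) (fun e => by simpa using hstep e Set.univ .univ)
  -- Almost every section of `B` is independent of the first `n` noise terms, by induction through
  -- `hstep`.
  have hbox (n : ℕ) : ∀ t : ℕ → Set W, (∀ i, MeasurableSet (t i)) →
      ∀ᵐ e ∂m, P ({w | (e, w) ∈ B} ∩ Set.pi (Finset.range n) t) =
        c * P (Set.pi (Finset.range n) t) := by
    induction n with
    | zero => intro t _; simpa using hc
    | succ n ih =>
      intro t ht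
      have hb (t : ℕ → Set W) (ht : ∀ i, MeasurableSet (t i)) (n : ℕ) :
          MeasurableSet (Set.pi (Finset.range n : Set ℕ) t) :=
        .pi (Finset.countable_toSet _) fun i _ => ht i
      have h1 := Measure.ae_ae_of_ae_prod
        (hκ.quasiMeasurePreserving.ae (ih (fun i => t (i + 1)) fun i => ht _))
      filter_upwards [h1] with e he
      have hpre (a : W) : {w | seqCons (a, w) ∈ Set.pi (Finset.range (n + 1) : Set ℕ) t} =
          if a ∈ t 0 then Set.pi (Finset.range n : Set ℕ) (fun i => t (i + 1)) else ∅ := by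
        ext w
        split_ifs with h
        · simp only [Set.mem_ofPred_eq, Set.mem_pi, Finset.mem_coe, Finset.mem_range]
          constructor
          · exact fun hw i hi => hw (i + 1) (by omega)
          · intro hw i hi
            cases i with
            | zero => exact h
            | succ i => exact hw i (by omega)
        · simp only [Set.mem_ofPred_eq, Set.mem_empty_iff_false, iff_false]
          exact fun hw => h (hw 0 (by simp))
      rw [hstep e _ (hb t ht _)]
      have h2 : ∀ᵐ a ∂ν, P ({w | (κ (e, a), w) ∈ B} ∩
          {w | seqCons (a, w) ∈ Set.pi (Finset.range (n + 1) : Set ℕ) t}) =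
          (t 0).indicator (fun _ => c * P (Set.pi (Finset.range n) fun i => t (i + 1))) a := by
        filter_upwards [he] with a ha
        rw [hpre]
        by_cases h : a ∈ t 0
        · simpa [h] using ha
        · simp [h]
      rw [lintegral_congr_ae h2, lintegral_indicator_const (ht 0),
        Measure.infinitePi_pi _ fun i _ => ht i, Measure.infinitePi_pi _ fun i _ => ht _,
        Finset.prod_range_succ', mul_assoc]
  have hbox' (s : Finset ℕ) (t : ℕ → Set W) (ht : ∀ i, MeasurableSet (t i)) :
      ∀ᵐ e ∂m, P ({w | (e, w) ∈ B} ∩ Set.pi s t) = c * P (Set.pi s t) := by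
    obtain ⟨n, hn⟩ := s.exists_nat_subset_range
    have hpi : Set.pi (s : Set ℕ) t =
        Set.pi (Finset.range n) fun i => if i ∈ s then t i else Set.univ := by
      ext w
      simp only [Set.mem_pi, Finset.mem_coe]
      refine ⟨fun h i _ => ?_, fun h i hi => by simpa [hi] using h i (hn hi)⟩
      split_ifs with hi
      exacts [h i hi, trivial]
    rw [hpi]
    refine hbox n _ fun i => ?_
    split_ifs
    exacts [ht i, .univ]
  have hc1 : c ≠ ∞ := by
    obtain ⟨e, he⟩ := hc.exists
    rw [← he]; exact measure_ne_top _ _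
  have hall (D : Set E) (hD : MeasurableSet D) :
      ((m.prod P).restrict (B ∩ D ×ˢ Set.univ)).snd = (c * m D) • P := by
    have hprob : ∀ C, MeasurableSet C →
        ((m.prod P).restrict (B ∩ D ×ˢ Set.univ)).snd C =
          ∫⁻ e in D, P ({w | (e, w) ∈ B} ∩ C) ∂m := by
      intro C hC
      rw [Measure.snd_apply hC, Measure.restrict_apply (measurable_snd hC),
        Measure.prod_apply ((measurable_snd hC).inter (hB.inter (hD.prod .univ))),
        ← lintegral_indicator hD]
      refine lintegral_congr fun e => ?_
      by_cases he : e ∈ D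
      · rw [Set.indicator_of_mem he]
        congr 1; ext w; simp [he, and_comm]
      · rw [Set.indicator_of_notMem he]
        convert measure_empty (μ := P)
        ext w; simp [he]
    set ρ := ((m.prod P).restrict (B ∩ D ×ˢ Set.univ)).snd
    have hρ (s : Finset ℕ) (t : ℕ → Set W) (ht : ∀ i, MeasurableSet (t i)) :
        ρ (Set.pi s t) = c * m D * P (Set.pi s t) := by
      rw [hprob _ (.pi s.countable_toSet fun i _ => ht i),
        lintegral_congr_ae (ae_restrict_of_ae (hbox' s t ht)), lintegral_const,
        Measure.restrict_apply .univ, Set.univ_inter]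
      ring
    -- Cylinders determine the product measure only after normalization, so zero mass is treated
    -- apart.
    rcases eq_or_ne (c * m D) 0 with h0 | h0
    · have h1 : ρ Set.univ = 0 := by simpa [h0] using hρ ∅ (fun _ => Set.univ) fun _ => .univ
      rw [h0, zero_smul]
      exact Measure.measure_univ_eq_zero.1 h1
    · have h2 : c * m D ≠ ∞ := ENNReal.mul_ne_top hc1 (measure_ne_top _ _)
      have h1 : (c * m D)⁻¹ • ρ = P := Measure.eq_infinitePi _ fun s t ht => by
        rw [Measure.smul_apply, hρ s t ht, smul_eq_mul, ← mul_assoc,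
          ENNReal.inv_mul_cancel h0 h2, one_mul, Measure.infinitePi_pi _ fun i _ => ht i]
      rw [← h1, smul_smul, ENNReal.mul_inv_cancel h0 h2, one_smul]
  have : IsFiniteMeasure (c • m) := Measure.smul_finite m hc1
  -- Restricting to `B` merely scales the measure by `c`; evaluating at `Bᶜ` then forces `c = 0` or
  -- `Bᶜ` null.
  have hres : (m.prod P).restrict B = (c • m).prod P := by
    symm
    refine Measure.prod_eq fun D C hD hC => ?_
    have := congrArg (fun μ => μ C) (hall D hD)
    simp only [Measure.snd_apply hC, Measure.smul_apply, smul_eq_mul] at this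
    rw [Measure.restrict_apply (measurable_snd hC)] at this
    rw [Measure.restrict_apply (hD.prod hC), Measure.smul_apply, smul_eq_mul, ← this]
    congr 1; ext p; simp; tauto
  rw [eventuallyConst_set]
  have h0 : c * (m.prod P) Bᶜ = 0 := by
    have := congrArg (fun μ => μ Bᶜ) hres
    rw [Measure.prod_smul_left] at this
    simpa [Measure.restrict_apply hB.compl] using this.symm
  rcases mul_eq_zero.1 h0 with h | h
  · right
    have := congrArg (fun μ => μ Set.univ) hres
    rw [Measure.prod_smul_left, h] at this
    rw [← measure_eq_zero_iff_ae_notMem]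
    simpa using this
  · exact Or.inl (measure_eq_zero_iff_ae_notMem.1 h |>.mono fun p hp => not_not.1 hp)

end SkewProduct

/-! ### The displacement function: continuity and linear lower bound. -/

namespace DoubleRotation

section Displacement

variable {k : ℕ} {A : Set (Torus k)}

theorem ofReal_displacement (A : Set (Torus k)) (u : Torus k) :
    ENNReal.ofReal (displacement A u) = volume (symmDiff A {x | x - u ∈ A}) := by
  rw [displacement, ENNReal.ofReal_toReal (measure_ne_top _ _), Set.image_add_right]
  simp only [← sub_eq_add_neg, Set.preimage]

theorem displacement_eq_toReal (A : Set (Torus k)) (u : Torus k) :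
    displacement A u = (volume (symmDiff A {x | x - u ∈ A})).toReal := by
  rw [← ofReal_displacement, displacement, ENNReal.toReal_ofReal ENNReal.toReal_nonneg]

theorem displacement_nonneg (A : Set (Torus k)) (u : Torus k) : 0 ≤ displacement A u :=
  ENNReal.toReal_nonneg

/-- Triangle inequality through `A + u`: the symmetric difference of `A + u` and `A + 2u` is a
translate of that of `A` and `A + u`. -/
theorem displacement_add_self_le (hA : MeasurableSet A) (u : Torus k) :
    displacement A (u + u) ≤ 2 * displacement A u := by
  have h : volume (symmDiff A {x | x - (u + u) ∈ A}) ≤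
      volume (symmDiff A {x | x - u ∈ A}) + volume (symmDiff A {x | x - u ∈ A}) := by
    refine (measure_symmDiff_le A {x | x - u ∈ A} _).trans (add_le_add le_rfl (le_of_eq ?_))
    have hm : MeasurableSet (symmDiff A {x | x - u ∈ A}) :=
      hA.symmDiff ((measurable_sub_const u) hA)
    rw [← (measurePreserving_sub_right volume u).measure_preimage hm.nullMeasurableSet]
    simp only [Set.preimage_symmDiff]
    congr 2
    ext x; simp [sub_sub]
  simp only [displacement_eq_toReal]
  rw [two_mul, ← ENNReal.toReal_add (measure_ne_top _ _) (measure_ne_top _ _)]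
  exact ENNReal.toReal_mono (by simp) h

theorem continuous_displacement (hA : MeasurableSet A) : Continuous (displacement A) := by
  have key (u : Torus k) :
      Tendsto (fun t => volume (symmDiff {x | x - t ∈ A} {x | x - u ∈ A})) (𝓝 u) (𝓝 0) := by
    let F : Torus k → C(Torus k, Torus k) :=
      fun t => ⟨fun x => x - t, continuous_id.sub continuous_const⟩
    have hF : Continuous F :=
      ContinuousMap.continuous_of_continuous_uncurry _ (continuous_snd.sub continuous_fst)
    have hmp (t : Torus k) : MeasurePreserving (F t) volume volume :=
      measurePreserving_sub_right volume t
    exact tendsto_measure_symmDiff_preimage_nhds_zero (f := F) (g := F u) (hF.tendsto u)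
      (.of_forall hmp) (hmp u) hA.nullMeasurableSet (measure_ne_top _ _)
  refine continuous_iff_continuousAt.2 fun u => ?_
  have h0 : Tendsto (fun t => (volume (symmDiff {x | x - t ∈ A} {x | x - u ∈ A})).toReal)
      (𝓝 u) (𝓝 0) := by
    simpa [Function.comp_def] using (ENNReal.tendsto_toReal ENNReal.zero_ne_top).comp (key u)
  refine tendsto_iff_dist_tendsto_zero.2 (squeeze_zero (fun _ => dist_nonneg) (fun t => ?_) h0)
  have tri (s t : Torus k) : displacement A s ≤ displacement A t +
      (volume (symmDiff {x | x - t ∈ A} {x | x - s ∈ A})).toReal := by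
    simp only [displacement_eq_toReal]
    rw [← ENNReal.toReal_add (measure_ne_top _ _) (measure_ne_top _ _)]
    exact ENNReal.toReal_mono (by simp) (measure_symmDiff_le _ _ _)
  have h1 := tri t u
  have h2 := tri u t
  rw [symmDiff_comm] at h1
  rw [Real.dist_eq, abs_le]
  constructor <;> linarith

theorem measurable_inverseDisplacement (hA : MeasurableSet A) :
    Measurable (inverseDisplacement A) :=
  (continuous_displacement hA).measurable.ennreal_ofReal.inv

/-- A representative with `|a| = ‖x‖ ≤ 1/4` still lies within half a period after doubling. -/
theorem _root_.UnitAddCircle.two_mul_norm_le_norm_add_self {x : UnitAddCircle}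
    (hx : ‖x‖ ≤ 1 / 4) : 2 * ‖x‖ ≤ ‖x + x‖ := by
  obtain ⟨a, rfl, ha⟩ : ∃ a : ℝ, (a : UnitAddCircle) = x ∧ ‖x‖ = |a| := by
    obtain ⟨a, rfl⟩ := QuotientAddGroup.mk_surjective x
    refine ⟨a - round a, ?_, UnitAddCircle.norm_eq⟩
    have : ((round a : ℝ) : UnitAddCircle) = 0 := by
      rw [AddCircle.coe_eq_zero_iff]
      exact ⟨round a, by simp⟩
    rw [AddCircle.coe_sub, this, sub_zero]
  have h2 : ‖((a + a : ℝ) : UnitAddCircle)‖ = |a + a| := by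
    rw [AddCircle.norm_coe_eq_abs_iff _ one_ne_zero, ← two_mul, abs_mul, abs_two, abs_one]
    linarith
  rw [AddCircle.coe_add] at h2
  rw [h2, ha, ← two_mul, abs_mul, abs_two]

theorem two_mul_norm_le_norm_add_self {u : Torus k} (hu : ‖u‖ ≤ 1 / 4) :
    2 * ‖u‖ ≤ ‖u + u‖ := by
  have h : ‖u‖ ≤ ‖u + u‖ / 2 := by
    refine (pi_norm_le_iff_of_nonneg (by positivity)).2 fun i => ?_
    have h1 := UnitAddCircle.two_mul_norm_le_norm_add_self ((norm_le_pi_norm u i).trans hu)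
    have h2 := norm_le_pi_norm (u + u) i
    rw [Pi.add_apply] at h2
    linarith
  linarith

theorem norm_le_half (u : Torus k) : ‖u‖ ≤ 1 / 2 :=
  (pi_norm_le_iff_of_nonneg (by norm_num)).2 fun i => by
    simpa using AddCircle.norm_le_half_period (1 : ℝ) (x := u i) one_ne_zero

theorem displacement_pos (hsymm : NoTranslationalSymmetries A) {u : Torus k} (hu : u ≠ 0) :
    0 < displacement A u :=
  (displacement_nonneg A u).lt_of_ne fun h => hu ((hsymm u).1 h.symm)

/-- The displacement grows at least linearly near the origin. -/
theorem exists_mul_norm_le_displacement (hA : MeasurableSet A)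
    (hsymm : NoTranslationalSymmetries A) :
    ∃ α : ℝ, 0 < α ∧ ∀ u : Torus k, α * ‖u‖ ≤ displacement A u := by
  obtain ⟨c, hc, hcK⟩ : ∃ c : ℝ, 0 < c ∧ ∀ u : Torus k, 1 / 8 ≤ ‖u‖ → c ≤ displacement A u := by
    have hK : IsCompact {u : Torus k | 1 / 8 ≤ ‖u‖} :=
      (isClosed_le continuous_const continuous_norm).isCompact
    obtain ⟨c, hc, h⟩ := hK.exists_forall_le' (continuous_displacement hA).continuousOn
      (a := 0) fun u hu => displacement_pos hsymm (norm_pos_iff.1 (lt_of_lt_of_le (by norm_num) hu))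
    exact ⟨c, hc, h⟩
  -- Double `u` until it leaves the ball of radius `1/8`: each doubling at least doubles the norm
  -- and at most doubles the displacement. The constant `2 * c` works far from the origin because
  -- `‖u‖ ≤ 1/2`.
  have main (n : ℕ) : ∀ u : Torus k, 1 / 8 * (1 / 2) ^ n ≤ ‖u‖ →
      2 * c * ‖u‖ ≤ displacement A u := by
    have far (u : Torus k) (hu : 1 / 8 ≤ ‖u‖) : 2 * c * ‖u‖ ≤ displacement A u := by
      nlinarith [hcK u hu, norm_le_half u]
    induction n with
    | zero => exact fun u hu => far u (by simpa using hu)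
    | succ n ih =>
      intro u hu
      by_cases h : 1 / 8 ≤ ‖u‖
      · exact far u h
      · have h1 := two_mul_norm_le_norm_add_self (u := u) (by linarith)
        have h2 := ih (u + u) (by rw [pow_succ] at hu; linarith)
        have h3 := displacement_add_self_le hA u
        nlinarith
  refine ⟨2 * c, by positivity, fun u => ?_⟩
  rcases eq_or_ne u 0 with rfl | hu
  · simpa using displacement_nonneg A 0
  · obtain ⟨n, hn⟩ := exists_pow_lt_of_lt_one (norm_pos_iff.2 hu) (by norm_num : (1 / 2 : ℝ) < 1)
    refine main n u ?_
    have : (0 : ℝ) < (1 / 2) ^ n := by positivity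
    linarith

end Displacement

/-! ### Finiteness of the stationary measure. -/

section Integrability

variable {k : ℕ} {A : Set (Torus k)}

/-- Quadratic decay is all that is needed of the dimension: it beats the singularity `1/‖u‖`, and at
`r = 0` it shows that points are null. -/
theorem volume_closedBall_le {r : ℝ} (hr : 0 ≤ r) (hk : 1 < k) :
    volume (Metric.closedBall (0 : Torus k) r) ≤ ENNReal.ofReal (2 * r) ^ 2 := by
  rw [volume_pi_closedBall _ hr]
  simp only [AddCircle.volume_closedBall, Finset.prod_const, Finset.card_univ, Fintype.card_fin]
  calc ENNReal.ofReal (min 1 (2 * r)) ^ k ≤ ENNReal.ofReal (min 1 (2 * r)) ^ 2 :=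
        pow_le_pow_right_of_le_one' (by simp) hk
    _ ≤ _ := by gcongr; exact min_le_right _ _

theorem volume_zero (hk : 1 < k) : volume ({0} : Set (Torus k)) = 0 := by
  simpa using volume_closedBall_le le_rfl hk

theorem lintegral_inv_enorm_lt_top (hk : 1 < k) : ∫⁻ u : Torus k, ‖u‖ₑ⁻¹ < ∞ := by
  have hae : ∀ᵐ u : Torus k, u ≠ 0 := by
    simpa [ae_iff] using volume_zero hk
  -- Dyadic shells: if `2^-(n+1) < ‖u‖ ≤ 2^-n`, the `n`-th term alone dominates. The integrals of
  -- the terms are at most `8 * 2^-n`.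
  have hpt : ∀ᵐ u : Torus k, ‖u‖ₑ⁻¹ ≤ ∑' n : ℕ,
      (Metric.closedBall (0 : Torus k) ((1 / 2) ^ n)).indicator (fun _ => (2 : ℝ≥0∞) ^ (n + 1)) u := by
    filter_upwards [hae] with u hu
    obtain ⟨n, h1, h2⟩ := exists_nat_pow_near_of_lt_one (norm_pos_iff.2 hu)
      ((norm_le_half u).trans (by norm_num)) (by norm_num : (0 : ℝ) < 1 / 2) (by norm_num)
    refine le_trans ?_ (ENNReal.le_tsum n)
    rw [Set.indicator_of_mem (by simpa using h2), ENNReal.inv_le_iff_inv_le, ← ofReal_norm]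
    rw [ENNReal.inv_pow, show (2 : ℝ≥0∞)⁻¹ = ENNReal.ofReal (1 / 2) by
      rw [one_div, ENNReal.ofReal_inv_of_pos two_pos]; simp, ← ENNReal.ofReal_pow (by norm_num)]
    exact ENNReal.ofReal_le_ofReal h1.le
  refine (lintegral_mono_ae hpt).trans_lt ?_
  rw [lintegral_tsum fun n => (measurable_const.indicator
    Metric.isClosed_closedBall.measurableSet).aemeasurable]
  calc ∑' n : ℕ, ∫⁻ u : Torus k, (Metric.closedBall (0 : Torus k) ((1 / 2) ^ n)).indicator
          (fun _ => (2 : ℝ≥0∞) ^ (n + 1)) u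
      ≤ ∑' n : ℕ, 8 * (2 : ℝ≥0∞)⁻¹ ^ n := by
        refine ENNReal.tsum_le_tsum fun n => ?_
        rw [lintegral_indicator_const Metric.isClosed_closedBall.measurableSet]
        refine (mul_le_mul_right (volume_closedBall_le (by positivity) hk) _).trans (le_of_eq ?_)
        rw [ENNReal.ofReal_mul (by norm_num), ENNReal.ofReal_pow (by norm_num), one_div,
          ENNReal.ofReal_inv_of_pos two_pos]
        simp only [ENNReal.ofReal_ofNat]
        have h : (2 : ℝ≥0∞) ^ n * 2⁻¹ ^ n = 1 := by
          rw [← mul_pow, ENNReal.mul_inv_cancel (by simp) (by simp), one_pow]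
        calc (2 : ℝ≥0∞) ^ (n + 1) * (2 * 2⁻¹ ^ n) ^ 2
            = 8 * (2 ^ n * 2⁻¹ ^ n) * 2⁻¹ ^ n := by ring
          _ = _ := by rw [h, mul_one]
    _ < ∞ := by
        rw [ENNReal.tsum_mul_left, ENNReal.tsum_geometric]
        exact ENNReal.mul_lt_top (by simp) (by simp)

theorem totalMass_lt_top (hk : 1 < k) (hA : MeasurableSet A)
    (hsymm : NoTranslationalSymmetries A) : totalMass A < ∞ := by
  obtain ⟨α, hα, h⟩ := exists_mul_norm_le_displacement hA hsymm
  calc totalMass A ≤ ∫⁻ u : Torus k, (ENNReal.ofReal α)⁻¹ * ‖u‖ₑ⁻¹ := by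
        refine lintegral_mono fun u => ?_
        rw [inverseDisplacement, ← ENNReal.mul_inv (by simp [hα]) (by simp), ← ofReal_norm,
          ← ENNReal.ofReal_mul hα.le]
        exact ENNReal.inv_le_inv.2 (ENNReal.ofReal_le_ofReal (h u))
    _ < ∞ := by
        rw [lintegral_const_mul _ (by fun_prop)]
        exact ENNReal.mul_lt_top (by simp [hα]) (lintegral_inv_enorm_lt_top hk)

theorem one_le_inverseDisplacement (A : Set (Torus k)) (u : Torus k) :
    1 ≤ inverseDisplacement A u := by
  rw [inverseDisplacement, ENNReal.one_le_inv, ofReal_displacement]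
  exact prob_le_one

theorem totalMass_ne_zero (A : Set (Torus k)) : totalMass A ≠ 0 := by
  have h : ∫⁻ _ : Torus k, 1 ≤ totalMass A := lintegral_mono fun u => one_le_inverseDisplacement A u
  intro h0
  simp [h0] at h

theorem isProbabilityMeasure_limitMeasure (hA : totalMass A < ∞) :
    IsProbabilityMeasure (limitMeasure A) := by
  refine ⟨?_⟩
  rw [limitMeasure, Measure.smul_apply, withDensity_apply _ .univ, Measure.restrict_univ,
    smul_eq_mul]
  exact ENNReal.inv_mul_cancel (totalMass_ne_zero A) hA.ne

theorem volume_absolutelyContinuous_limitMeasure (hA : MeasurableSet A) (hZ : totalMass A < ∞) :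
    (volume : Measure (Torus k)) ≪ limitMeasure A := by
  refine (withDensity_absolutelyContinuous' (measurable_inverseDisplacement hA).aemeasurable
    (ae_of_all _ fun u => (one_pos.trans_le (one_le_inverseDisplacement A u)).ne')).trans ?_
  exact Measure.absolutelyContinuous_smul (ENNReal.inv_ne_zero.2 hZ.ne)

end Integrability

end DoubleRotation

/-! ### Fourier rigidity of measures harmonic for the steps `± v`. -/

namespace DoubleRotation

section Rigidity

open UnitAddTorus

variable {k : ℕ}

theorem mFourier_apply_add (n : Fin k → ℤ) (x y : Torus k) :
    mFourier n (x + y) = mFourier n x * mFourier n y := by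
  simp [mFourier, fourier_apply, smul_add, AddCircle.toCircle_add, Finset.prod_mul_distrib]

theorem mFourier_apply_zero (n : Fin k → ℤ) : mFourier n (0 : Torus k) = 1 := by
  simp [mFourier]

/-- If the character were trivial at `v`, then `∑ n i * a i` would be an integer `l`, a rational
relation between `1` and the components. -/
theorem mFourier_ne_one {v : Torus k} (hv : RationallyIndependent v) {n : Fin k → ℤ}
    (hn : n ≠ 0) : mFourier n v ≠ 1 := by
  obtain ⟨a, ha, hind⟩ := hv
  intro h
  have h1 : mFourier n v = Complex.exp (2 * Real.pi * Complex.I * ∑ i, (n i : ℂ) * a i) := by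
    rw [Finset.mul_sum, Complex.exp_sum]
    change ∏ i, fourier (n i) (v i) = _
    refine Finset.prod_congr rfl fun i _ => ?_
    rw [← ha i, fourier_coe_apply]
    congr 1; push_cast; ring
  rw [h1, Complex.exp_eq_one_iff] at h
  obtain ⟨l, hl⟩ := h
  have h2 : ∑ i, (n i : ℂ) * a i = l := by
    have : (2 * Real.pi * Complex.I : ℂ) ≠ 0 := Complex.two_pi_I_ne_zero
    exact mul_left_cancel₀ this (by rw [hl]; ring)
  have h3 : ∑ i, (n i : ℝ) * a i = l := by exact_mod_cast h2
  have h4 := Fintype.linearIndependent_iff.1 hind (Fin.cons (-l) fun i => n i) (by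
    rw [Fin.sum_univ_succ]
    simp only [Fin.cons_zero, Fin.cons_succ, Rat.smul_def]
    push_cast
    rw [h3]; ring)
  exact hn (funext fun i => by simpa using h4 i.succ)

/-- Trigonometric polynomials form a star subalgebra that separates points, and the characters span
it. -/
theorem ext_of_integral_mFourier_eq {ρ ρ' : Measure (Torus k)} [IsFiniteMeasure ρ]
    [IsFiniteMeasure ρ'] (h : ∀ n, ∫ x, mFourier n x ∂ρ = ∫ x, mFourier n x ∂ρ') : ρ = ρ' := by
  have hint (f : C(Torus k, ℂ)) (σ : Measure (Torus k)) [IsFiniteMeasure σ] : Integrable f σ :=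
    (BoundedContinuousFunction.mkOfCompact f).integrable σ
  refine ext_of_forall_mem_subalgebra_integral_eq_of_polish (𝕜 := ℂ)
    (A := (mFourierSubalgebra (Fin k)).comap
      (BoundedContinuousFunction.toContinuousMapStarₐ ℂ)) ?_ fun g hg => ?_
  · intro x y hxy
    obtain ⟨_, ⟨f, hf, rfl⟩, hne⟩ := mFourierSubalgebra_separatesPoints hxy
    exact ⟨_, ⟨f, ⟨BoundedContinuousFunction.mkOfCompact f, hf, rfl⟩, rfl⟩, hne⟩
  · have hg' : (g : C(Torus k, ℂ)) ∈ Submodule.span ℂ (Set.range (mFourier (d := Fin k))) := by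
      rw [← mFourierSubalgebra_coe]; exact hg
    change ∫ x, (g : C(Torus k, ℂ)) x ∂ρ = ∫ x, (g : C(Torus k, ℂ)) x ∂ρ'
    generalize (g : C(Torus k, ℂ)) = f at hg'
    induction hg' using Submodule.span_induction with
    | mem f hf => obtain ⟨n, rfl⟩ := hf; exact h n
    | zero => simp
    | add f₁ f₂ _ _ h₁ h₂ =>
      simp only [ContinuousMap.add_apply]
      rw [integral_add (hint _ _) (hint _ _), integral_add (hint _ _) (hint _ _), h₁, h₂]
    | smul c f _ hf => simp only [ContinuousMap.smul_apply, integral_smul, hf]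

/-- Translation by `± v` multiplies the coefficient by `χ(± v)`. A nonzero coefficient would give
`χ(v) + χ(-v) = 2`; with `χ(v) χ(-v) = 1` this reads `(χ(v) - 1)^2 = 0`. -/
theorem integral_mFourier_eq_zero {v : Torus k} (hv : RationallyIndependent v)
    {ρ : Measure (Torus k)} [IsFiniteMeasure ρ]
    (h : ρ + ρ = ρ.map (fun x => x + v) + ρ.map (fun x => x + -v)) {n : Fin k → ℤ} (hn : n ≠ 0) :
    ∫ x, mFourier n x ∂ρ = 0 := by
  have hint (σ : Measure (Torus k)) [IsFiniteMeasure σ] : Integrable (mFourier n) σ :=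
    (BoundedContinuousFunction.mkOfCompact (mFourier n)).integrable σ
  have hmap (a : Torus k) : ∫ x, mFourier n x ∂(ρ.map fun x => x + a) =
      (∫ x, mFourier n x ∂ρ) * mFourier n a := by
    rw [integral_map (measurable_add_const a).aemeasurable
      (mFourier n).continuous.aestronglyMeasurable]
    simp only [mFourier_apply_add, integral_mul_const]
  have h1 : ∫ x, mFourier n x ∂(ρ + ρ) =
      ∫ x, mFourier n x ∂(ρ.map (fun x => x + v) + ρ.map (fun x => x + -v)) := by rw [h]
  rw [integral_add_measure (hint _) (hint _), integral_add_measure (hint _) (hint _), hmap, hmap]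
    at h1
  have h2 : mFourier n v * mFourier n (-v) = 1 := by
    rw [← mFourier_apply_add, add_neg_cancel, mFourier_apply_zero]
  by_contra h0
  have h3 : mFourier n v + mFourier n (-v) = 2 := by
    refine mul_left_cancel₀ h0 ?_
    rw [mul_add, ← h1]; ring
  refine mFourier_ne_one hv hn (sub_eq_zero.1 (pow_eq_zero_iff two_ne_zero |>.1 ?_))
  linear_combination mFourier n v * h3 - h2

/-- A finite measure which is harmonic for the symmetric walk with steps `± v` is a multiple of
the Lebesgue measure. -/
theorem eq_smul_volume_of_harmonic {v : Torus k} (hv : RationallyIndependent v)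
    {ρ : Measure (Torus k)} [IsFiniteMeasure ρ]
    (h : ρ + ρ = ρ.map (fun x => x + v) + ρ.map (fun x => x + -v)) :
    ρ = ρ Set.univ • volume := by
  have : IsFiniteMeasure (ρ Set.univ • (volume : Measure (Torus k))) :=
    Measure.smul_finite _ (measure_ne_top _ _)
  refine ext_of_integral_mFourier_eq fun n => ?_
  rcases eq_or_ne n 0 with rfl | hn
  · simp [mFourier_zero, Measure.real]
  · rw [integral_mFourier_eq_zero hv h hn, integral_smul_measure,
      integral_mFourier_eq_zero hv (ρ := volume) ?_ hn, smul_zero]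
    rw [map_add_right_eq_self, map_add_right_eq_self]

end Rigidity

/-! ### The Markov chain of the differences. -/

section Transition

variable {k : ℕ} {A : Set (Torus k)}

theorem measurable_doubleRotation (hA : MeasurableSet A) (v : Torus k) :
    Measurable (doubleRotation A v) := by
  classical
  exact Measurable.ite hA (measurable_add_const v) measurable_id

/-- The law of the next difference, given the present difference `z` and a uniformly distributed
first point. -/
theorem lintegral_comp_doubleRotation_sub (hA : MeasurableSet A) (v z : Torus k)
    (γ : Torus k → ℝ≥0∞) :
    ∫⁻ x, γ (doubleRotation A v x - doubleRotation A v (x - z)) =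
      (1 - ENNReal.ofReal (displacement A z)) * γ z +
        ENNReal.ofReal (displacement A z) * (2⁻¹ * γ (z + v) + 2⁻¹ * γ (z - v)) := by
  classical
  set A' : Set (Torus k) := {x | x - z ∈ A} with hA'
  have hA'm : MeasurableSet A' := measurable_sub_const z hA
  have hvol : volume A = volume A' :=
    ((measurePreserving_sub_right volume z).measure_preimage hA.nullMeasurableSet).symm
  -- `A` and its translate `A'` have equal measure, which makes the jumps `+v` and `-v` equally
  -- likely.
  have hD : volume (A \ A') = volume (A' \ A) :=
    measure_sdiff_symm hA.nullMeasurableSet hA'm.nullMeasurableSet hvol (measure_ne_top _ _)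
  have hsd : ENNReal.ofReal (displacement A z) = volume (A \ A') + volume (A' \ A) := by
    rw [ofReal_displacement, Set.symmDiff_def,
      measure_union disjoint_sdiff_sdiff (hA'm.diff hA)]
  have hhalf : volume (A \ A') = ENNReal.ofReal (displacement A z) * 2⁻¹ := by
    rw [hsd, ← hD, ← two_mul, mul_comm, ← mul_assoc, ENNReal.inv_mul_cancel (by simp) (by simp),
      one_mul]
  have hstay : volume (symmDiff A A')ᶜ = 1 - ENNReal.ofReal (displacement A z) := by
    rw [prob_compl_eq_one_sub (hA.symmDiff hA'm), ofReal_displacement]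
  have hpt (x : Torus k) : γ (doubleRotation A v x - doubleRotation A v (x - z)) =
      (symmDiff A A')ᶜ.indicator (fun _ => γ z) x + (A \ A').indicator (fun _ => γ (z + v)) x +
        (A' \ A).indicator (fun _ => γ (z - v)) x := by
    have hx' : x - z ∈ A ↔ x ∈ A' := Iff.rfl
    by_cases h1 : x ∈ A <;> by_cases h2 : x ∈ A' <;>
      simp only [doubleRotation, hx', h1, h2, Set.indicator, Set.mem_compl_iff,
        Set.mem_symmDiff, Set.mem_sdiff, if_true, if_false, not_true, not_false_iff, and_true,
        and_false, or_false, false_or, add_zero, zero_add, or_self, and_self] <;>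
      congr 1 <;> abel
  simp only [hpt]
  rw [lintegral_add_right _ (measurable_const.indicator (hA'm.diff hA)),
    lintegral_add_right _ (measurable_const.indicator (hA.diff hA'm)),
    lintegral_indicator_const (hA.symmDiff hA'm).compl, lintegral_indicator_const (hA.diff hA'm),
    lintegral_indicator_const (hA'm.diff hA), ← hD, hstay, hhalf]
  ring

theorem inverseDisplacement_mul_cancel (hsymm : NoTranslationalSymmetries A) {z : Torus k}
    (hz : z ≠ 0) : inverseDisplacement A z * ENNReal.ofReal (displacement A z) = 1 :=
  ENNReal.inv_mul_cancel (ENNReal.ofReal_pos.2 (displacement_pos hsymm hz)).ne' ENNReal.ofReal_ne_top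

theorem ofReal_displacement_le_one (A : Set (Torus k)) (z : Torus k) :
    ENNReal.ofReal (displacement A z) ≤ 1 := by
  rw [ofReal_displacement]; exact prob_le_one

theorem ae_ne_zero (hk : 1 < k) : ∀ᵐ z : Torus k, z ≠ 0 := by
  simpa [ae_iff] using volume_zero hk

/-- The measure with density `1/φ_A` is stationary for the chain of the differences. -/
theorem lintegral_inverseDisplacement_mul_transition (hk : 1 < k) (hA : MeasurableSet A)
    (hsymm : NoTranslationalSymmetries A) (v : Torus k) {γ : Torus k → ℝ≥0∞}
    (hγ : Measurable γ) :
    ∫⁻ z, inverseDisplacement A z *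
      ∫⁻ x, γ (doubleRotation A v x - doubleRotation A v (x - z)) =
    ∫⁻ z, inverseDisplacement A z * γ z := by
  have hφ : Measurable fun z => ENNReal.ofReal (displacement A z) :=
    (continuous_displacement hA).measurable.ennreal_ofReal
  have hI := measurable_inverseDisplacement hA
  -- The density cancels the jump probability, so the jump part becomes a plain Lebesgue integral,
  -- to which translation invariance applies.
  have h1 : ∀ᵐ z : Torus k, inverseDisplacement A z *
      ∫⁻ x, γ (doubleRotation A v x - doubleRotation A v (x - z)) =
      inverseDisplacement A z * (1 - ENNReal.ofReal (displacement A z)) * γ z +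
        (2⁻¹ * γ (z + v) + 2⁻¹ * γ (z - v)) := by
    filter_upwards [ae_ne_zero hk] with z hz
    rw [lintegral_comp_doubleRotation_sub hA, mul_add, ← mul_assoc, ← mul_assoc,
      inverseDisplacement_mul_cancel hsymm hz, one_mul]
  have h2 : ∀ᵐ z : Torus k, inverseDisplacement A z * γ z =
      inverseDisplacement A z * (1 - ENNReal.ofReal (displacement A z)) * γ z + γ z := by
    filter_upwards [ae_ne_zero hk] with z hz
    conv_lhs => rw [← mul_one (inverseDisplacement A z),
      ← tsub_add_cancel_of_le (ofReal_displacement_le_one A z), mul_add,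
      inverseDisplacement_mul_cancel hsymm hz, add_mul, one_mul]
  have hm : Measurable fun z =>
      inverseDisplacement A z * (1 - ENNReal.ofReal (displacement A z)) * γ z :=
    (hI.mul (measurable_const.sub hφ)).mul hγ
  rw [lintegral_congr_ae h1, lintegral_congr_ae h2, lintegral_add_left hm, lintegral_add_left hm,
    lintegral_add_left (by fun_prop), lintegral_const_mul _ (by fun_prop),
    lintegral_const_mul _ (by fun_prop), lintegral_add_right_eq_self γ v,
    lintegral_sub_right_eq_self γ v, ← add_mul, ENNReal.inv_two_add_inv_two, one_mul]

/-- Bounded harmonic functions of the chain of the differences are constant. -/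
theorem ae_eq_const_of_harmonic (hk : 1 < k) {v : Torus k} (hv : RationallyIndependent v)
    (hA : MeasurableSet A) (hsymm : NoTranslationalSymmetries A) {γ : Torus k → ℝ≥0∞}
    (hγ : Measurable γ) (hγ1 : ∀ z, γ z ≤ 1)
    (hharm : ∀ z, γ z = ∫⁻ x, γ (doubleRotation A v x - doubleRotation A v (x - z))) :
    ∃ c, ∀ᵐ z : Torus k, γ z = c := by
  have hfin (z : Torus k) : γ z ≠ ∞ := ((hγ1 z).trans_lt ENNReal.one_lt_top).ne
  -- Cancel the lazy part `(1 - p) * γ z`, then divide by `p`, which is positive away from the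
  -- origin.
  have hmean : ∀ᵐ z : Torus k, γ z = 2⁻¹ * γ (z + v) + 2⁻¹ * γ (z - v) := by
    filter_upwards [ae_ne_zero hk] with z hz
    have h := hharm z
    rw [lintegral_comp_doubleRotation_sub hA] at h
    set p := ENNReal.ofReal (displacement A z)
    have hp1 : p ≤ 1 := ofReal_displacement_le_one A z
    have hp0 : p ≠ 0 := (ENNReal.ofReal_pos.2 (displacement_pos hsymm hz)).ne'
    have h' : (1 - p) * γ z + p * γ z = (1 - p) * γ z + p * (2⁻¹ * γ (z + v) + 2⁻¹ * γ (z - v)) := by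
      rw [← h, ← add_mul, tsub_add_cancel_of_le hp1, one_mul]
    have h2 := (ENNReal.add_right_inj (ENNReal.mul_ne_top (by finiteness) (hfin z))).1 h'
    exact (ENNReal.mul_right_inj hp0 (by finiteness)).1 h2
  -- The mean value property of `γ` becomes harmonicity of the measure `γ dz`, to which rigidity
  -- applies.
  set ρ := (volume : Measure (Torus k)).withDensity γ with hρ
  have hlt : ∫⁻ z, γ z ≠ ∞ :=
    ((lintegral_mono hγ1).trans_lt (by simp)).ne
  have : IsFiniteMeasure ρ := isFiniteMeasure_withDensity hlt
  have hmap (a : Torus k) : ρ.map (fun x => x + a) = volume.withDensity fun z => γ (z - a) := by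
    ext s hs
    rw [Measure.map_apply (measurable_add_const a) hs, withDensity_apply _ hs,
      withDensity_apply _ (measurable_add_const a hs), ← lintegral_indicator hs,
      ← lintegral_indicator (measurable_add_const a hs),
      ← lintegral_add_right_eq_self (s.indicator fun z => γ (z - a)) a]
    refine lintegral_congr fun z => ?_
    by_cases hz : z + a ∈ s <;> simp [hz, Set.indicator]
  have hsum : ρ + ρ = ρ.map (fun x => x + v) + ρ.map (fun x => x + -v) := by
    rw [hmap, hmap, hρ, ← withDensity_add_left hγ, ← withDensity_add_left (by fun_prop)]
    refine withDensity_congr_ae ?_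
    filter_upwards [hmean] with z hz
    simp only [Pi.add_apply, sub_neg_eq_add]
    rw [hz, ← two_mul, mul_add, ← mul_assoc, ← mul_assoc,
      ENNReal.mul_inv_cancel (by simp) (by simp), one_mul, one_mul, add_comm]
  have hvol := eq_smul_volume_of_harmonic hv hsum
  rw [← withDensity_const, hρ] at hvol
  exact ⟨_, (withDensity_eq_iff hγ.aemeasurable aemeasurable_const hlt).1 hvol⟩

end Transition

end DoubleRotation

/-! ### The motion of pairs and its time averages. -/

namespace DoubleRotation

section TwoPointMotion

variable {k : ℕ} {A : Set (Torus k)}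

/-- One step of the random motion of a pair of points driven by the same noise. -/
noncomputable def pairStep (A : Set (Torus k)) (v : Torus k) (q : (Torus k × Torus k) × Torus k) :
    Torus k × Torus k :=
  (doubleRotation A v q.1.1 + q.2, doubleRotation A v q.1.2 + q.2)

/-- The stationary distribution of the motion of pairs: the first point is uniformly distributed
and the difference is independent of it, with distribution `limitMeasure A`. -/
noncomputable def pairMeasure (A : Set (Torus k)) : Measure (Torus k × Torus k) :=
  (totalMass A)⁻¹ • volume.withDensity fun p => inverseDisplacement A (p.1 - p.2)

theorem measurable_pairStep (hA : MeasurableSet A) (v : Torus k) : Measurable (pairStep A v) := by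
  have := measurable_doubleRotation hA v
  unfold pairStep
  fun_prop

/-- The shear to the coordinates (first point, difference) preserves Lebesgue measure. -/
theorem lintegral_prod_eq_lintegral_sub {g : Torus k × Torus k → ℝ≥0∞} (hg : Measurable g) :
    ∫⁻ p, g p = ∫⁻ z, ∫⁻ x, g (x, x - z) := by
  calc ∫⁻ p, g p = ∫⁻ y, ∫⁻ x, g (x, y) := by
        rw [Measure.volume_eq_prod, lintegral_prod_symm _ hg.aemeasurable]
    _ = ∫⁻ y, ∫⁻ z, g (y + z, y) :=
        lintegral_congr fun y => (lintegral_add_left_eq_self (fun x => g (x, y)) y).symm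
    _ = ∫⁻ z, ∫⁻ y, g (y + z, y) := lintegral_lintegral_swap (by fun_prop)
    _ = ∫⁻ z, ∫⁻ x, g (x, x - z) := lintegral_congr fun z => by
        rw [← lintegral_sub_right_eq_self _ z]
        simp only [sub_add_cancel]

theorem lintegral_pairMeasure (hA : MeasurableSet A) {g : Torus k × Torus k → ℝ≥0∞}
    (hg : Measurable g) :
    ∫⁻ p, g p ∂(pairMeasure A) =
      (totalMass A)⁻¹ * ∫⁻ z, inverseDisplacement A z * ∫⁻ x, g (x, x - z) := by
  have hI := measurable_inverseDisplacement hA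
  have hI' : Measurable fun p : Torus k × Torus k => inverseDisplacement A (p.1 - p.2) := by
    fun_prop
  rw [pairMeasure, lintegral_smul_measure, lintegral_withDensity_eq_lintegral_mul _ hI' hg,
    lintegral_prod_eq_lintegral_sub (hI'.mul hg), smul_eq_mul]
  congr 1
  refine lintegral_congr fun z => ?_
  simp only [Pi.mul_apply, sub_sub_cancel]
  exact lintegral_const_mul _ (by fun_prop)

theorem map_sub_pairMeasure (hA : MeasurableSet A) :
    (pairMeasure A).map (fun p => p.1 - p.2) = limitMeasure A := by
  refine Measure.ext_of_lintegral _ fun g hg => ?_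
  rw [lintegral_map hg (by fun_prop), lintegral_pairMeasure hA (by fun_prop), limitMeasure,
    lintegral_smul_measure,
    lintegral_withDensity_eq_lintegral_mul _ (measurable_inverseDisplacement hA) hg, smul_eq_mul]
  simp

theorem isProbabilityMeasure_pairMeasure (hA : MeasurableSet A) (hZ : totalMass A < ∞) :
    IsProbabilityMeasure (pairMeasure A) := by
  have := isProbabilityMeasure_limitMeasure hZ
  rw [← map_sub_pairMeasure hA] at this
  exact Measure.isProbabilityMeasure_of_map (fun p : Torus k × Torus k => p.1 - p.2)

theorem volume_absolutelyContinuous_pairMeasure (hA : MeasurableSet A) (hZ : totalMass A < ∞) :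
    (volume : Measure (Torus k × Torus k)) ≪ pairMeasure A := by
  have hI := measurable_inverseDisplacement hA
  have hI' : Measurable fun p : Torus k × Torus k => inverseDisplacement A (p.1 - p.2) := by
    fun_prop
  refine (withDensity_absolutelyContinuous' hI'.aemeasurable
    (ae_of_all _ fun p => (one_pos.trans_le (one_le_inverseDisplacement A _)).ne')).trans ?_
  exact Measure.absolutelyContinuous_smul (ENNReal.inv_ne_zero.2 hZ.ne)

/-- The mean of a function after one step depends only on the difference of the images. -/
theorem lintegral_pairStep (v : Torus k) (g : Torus k × Torus k → ℝ≥0∞) (p : Torus k × Torus k) :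
    ∫⁻ u, g (pairStep A v (p, u)) =
      ∫⁻ t, g (t, t - (doubleRotation A v p.1 - doubleRotation A v p.2)) := by
  rw [← lintegral_add_left_eq_self (fun t => g (t, t - _)) (doubleRotation A v p.1)]
  refine lintegral_congr fun u => congrArg g ?_
  simp only [pairStep, Prod.mk.injEq, true_and]
  abel

/-- After a step, a test function `g` enters only through `γ z = ∫ g (t, t - z) dt`, so the claim
reduces to stationarity of the difference chain. -/
theorem measurePreserving_pairStep (hk : 1 < k) (hA : MeasurableSet A)
    (hsymm : NoTranslationalSymmetries A) (v : Torus k) :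
    MeasurePreserving (pairStep A v) ((pairMeasure A).prod volume) (pairMeasure A) := by
  have hf := measurable_doubleRotation hA v
  refine ⟨measurable_pairStep hA v, Measure.ext_of_lintegral _ fun g hg => ?_⟩
  have hγ : Measurable fun z : Torus k => ∫⁻ t, g (t, t - z) :=
    Measurable.lintegral_prod_right' (f := fun q : Torus k × Torus k => g (q.2, q.2 - q.1))
      (by fun_prop)
  rw [lintegral_map hg (measurable_pairStep hA v),
    lintegral_prod (fun q => g (pairStep A v q))
      (hg.comp (measurable_pairStep hA v)).aemeasurable]
  simp only [lintegral_pairStep]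
  rw [lintegral_pairMeasure hA (g := fun p => ∫⁻ t, g (t, t -
      (doubleRotation A v p.1 - doubleRotation A v p.2)))
      (hγ.comp (g := fun z : Torus k => ∫⁻ t, g (t, t - z)) (by fun_prop)), lintegral_pairMeasure hA hg,
    ← lintegral_inverseDisplacement_mul_transition hk hA hsymm v hγ]

/-- A harmonic function `h` of the pair is a function `γ` of the difference after applying `f`, and
`γ` is harmonic for the difference chain, hence almost everywhere constant. -/
theorem ergodic_skewProduct_pairStep (hk : 1 < k) {v : Torus k} (hv : RationallyIndependent v)
    (hA : MeasurableSet A) (hsymm : NoTranslationalSymmetries A) :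
    Ergodic (skewProduct (pairStep A v)) ((pairMeasure A).prod (noise k)) := by
  have hZ := totalMass_lt_top hk hA hsymm
  have := isProbabilityMeasure_pairMeasure hA hZ
  have hf := measurable_doubleRotation hA v
  refine ergodic_skewProduct (measurePreserving_pairStep hk hA hsymm v) fun h hh hh1 hharm => ?_
  set γ : Torus k → ℝ≥0∞ := fun z => ∫⁻ t, h (t, t - z) with hγ
  have hγm : Measurable γ :=
    Measurable.lintegral_prod_right' (f := fun q : Torus k × Torus k => h (q.2, q.2 - q.1))
      (by fun_prop)
  have hstep (p : Torus k × Torus k) :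
      h p = γ (doubleRotation A v p.1 - doubleRotation A v p.2) := by
    rw [hharm p, lintegral_pairStep]
  obtain ⟨c, hc⟩ := ae_eq_const_of_harmonic hk hv hA hsymm hγm
    (fun z => (lintegral_mono fun t => hh1 _).trans (by simp))
    (fun z => lintegral_congr fun x => hstep (x, x - z))
  refine ⟨c, ?_⟩
  -- After applying `f` the difference is shifted by `0`, `v` or `-v`, so three translates of the
  -- null set suffice.
  have hc' (a : Torus k) : ∀ᵐ p ∂(pairMeasure A), γ (p.1 - p.2 + a) = c := by
    have h1 : ∀ᵐ z : Torus k, γ (z + a) = c :=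
      (measurePreserving_add_right volume a).quasiMeasurePreserving.ae hc
    have h2 : ∀ᵐ z ∂(limitMeasure A), γ (z + a) = c :=
      ((withDensity_absolutelyContinuous _ _).smul_left _).ae_le h1
    rw [← map_sub_pairMeasure hA] at h2
    exact ae_of_ae_map (by fun_prop) h2
  filter_upwards [hc' 0, hc' v, hc' (-v)] with p h0 h1 h2
  rw [hstep, doubleRotation, doubleRotation]
  split_ifs
  · rwa [show p.1 + v - (p.2 + v) = p.1 - p.2 + 0 by abel]
  · rwa [show p.1 + v - p.2 = p.1 - p.2 + v by abel]
  · rwa [show p.1 - (p.2 + v) = p.1 - p.2 + -v by abel]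
  · rwa [show p.1 - p.2 = p.1 - p.2 + 0 by abel]

theorem iterate_skewProduct_pairStep (A : Set (Torus k)) (v : Torus k) (p : Torus k × Torus k)
    (w : ℕ → Torus k) (n : ℕ) :
    (skewProduct (pairStep A v))^[n] (p, w) =
      ((randomIterate A v w n p.1, randomIterate A v w n p.2), fun j => w (j + n)) := by
  induction n with
  | zero => rfl
  | succ n ih =>
    rw [Function.iterate_succ_apply', ih]
    simp [skewProduct, pairStep, randomIterate, add_assoc, add_comm 1]

/-- Time averages of a bounded function of the differences along almost every orbit. -/
theorem ae_tendsto_average_difference (hk : 1 < k) {v : Torus k} (hv : RationallyIndependent v)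
    (hA : MeasurableSet A) (hsymm : NoTranslationalSymmetries A) {g : Torus k → ℝ}
    (hg : Measurable g) {C : ℝ} (hC : ∀ z, |g z| ≤ C) :
    ∀ᵐ p : Torus k × Torus k, ∀ᵐ w ∂(noise k), Tendsto (fun N : ℕ => (N : ℝ)⁻¹ *
      ∑ n ∈ Finset.Icc 1 N, g (randomIterate A v w n p.1 - randomIterate A v w n p.2))
      atTop (𝓝 (∫ z, g z ∂(limitMeasure A))) := by
  have hZ := totalMass_lt_top hk hA hsymm
  have := isProbabilityMeasure_pairMeasure hA hZ
  have : IsProbabilityMeasure (noise k) := by unfold noise; infer_instance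
  have hΘ := ergodic_skewProduct_pairStep hk hv hA hsymm
  set Θ := skewProduct (pairStep A v)
  set F : (Torus k × Torus k) × (ℕ → Torus k) → ℝ := fun q => g (q.1.1 - q.1.2) with hF
  have hFm : Measurable F := by fun_prop
  have hint : ∫ q, F (Θ q) ∂((pairMeasure A).prod (noise k)) = ∫ z, g z ∂(limitMeasure A) := by
    rw [← map_sub_pairMeasure hA, integral_map (by fun_prop) hg.aestronglyMeasurable]
    calc ∫ q, F (Θ q) ∂((pairMeasure A).prod (noise k))
        = ∫ q, F q ∂((pairMeasure A).prod (noise k)) := by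
          conv_rhs => rw [← hΘ.map_eq]
          exact (integral_map hΘ.measurable.aemeasurable hFm.aestronglyMeasurable).symm
      _ = _ := by
          rw [integral_fun_fst (f := fun p : Torus k × Torus k => g (p.1 - p.2))]
          simp
  -- Birkhoff sums start at time `0` and the empirical averages at time `1`; composing with `Θ`
  -- makes the shift.
  have h := hΘ.ae_tendsto_birkhoffAverage (g := fun q => F (Θ q)) (hFm.comp hΘ.measurable)
    (fun q => hC _)
  rw [hint] at h
  refine (volume_absolutelyContinuous_pairMeasure hA hZ).ae_le ?_
  filter_upwards [Measure.ae_ae_of_ae_prod h] with p hp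
  filter_upwards [hp] with w hw
  convert hw using 2 with N
  rw [birkhoffAverage, birkhoffSum, smul_eq_mul, Finset.range_eq_Ico,
    ← Finset.Ico_add_one_right_eq_Icc, Finset.sum_Ico_add' (fun n =>
      g (randomIterate A v w n p.1 - randomIterate A v w n p.2)) 0 N 1 |>.symm]
  congr 1
  refine Finset.sum_congr rfl fun n _ => ?_
  rw [← Function.iterate_succ_apply' Θ, iterate_skewProduct_pairStep]

theorem integral_empiricalDifference (A : Set (Torus k)) (v : Torus k) (w : ℕ → Torus k)
    (x y : Torus k) (N : ℕ) (g : C(Torus k, ℝ)) :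
    ∫ z, g z ∂(empiricalDifference A v w x y N : Measure (Torus k)) = (N : ℝ)⁻¹ *
      ∑ n ∈ Finset.Icc 1 N, g (randomIterate A v w n x - randomIterate A v w n y) := by
  rw [empiricalDifference, FiniteMeasure.toMeasure_smul, FiniteMeasure.toMeasure_sum]
  rw [integral_smul_nnreal_measure, integral_finsetSum_measure (f := g) fun n _ =>
    (BoundedContinuousFunction.mkOfCompact g).integrable _]
  simp [pointMass, NNReal.smul_def]

/-- Weak convergence of empirical averages follows from the convergence of the averages of a dense
sequence of continuous functions. -/
theorem tendsto_average_of_denseRange {X ι : Type*} [TopologicalSpace X] [CompactSpace X]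
    [MeasurableSpace X] [OpensMeasurableSpace X] {μ : Measure X} [IsProbabilityMeasure μ]
    {s : ℕ → X} {φ : ι → C(X, ℝ)} (hφ : DenseRange φ)
    (h : ∀ i, Tendsto (fun N : ℕ => (N : ℝ)⁻¹ * ∑ n ∈ Finset.Icc 1 N, φ i (s n)) atTop
      (𝓝 (∫ z, φ i z ∂μ))) (g : C(X, ℝ)) :
    Tendsto (fun N : ℕ => (N : ℝ)⁻¹ * ∑ n ∈ Finset.Icc 1 N, g (s n)) atTop
      (𝓝 (∫ z, g z ∂μ)) := by
  have hint (f : C(X, ℝ)) : Integrable f μ :=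
    (BoundedContinuousFunction.mkOfCompact f).integrable μ
  rw [Metric.tendsto_atTop]
  intro ε hε
  obtain ⟨i, hi⟩ := hφ.exists_dist_lt g (by positivity : 0 < ε / 3)
  obtain ⟨M, hM⟩ := Metric.tendsto_atTop.1 (h i) (ε / 3) (by positivity)
  have hpt (x : X) : |g x - φ i x| ≤ ε / 3 :=
    (ContinuousMap.dist_apply_le_dist x).trans hi.le
  refine ⟨M, fun N hN => ?_⟩
  have h1 := hM N hN
  have h2 : |(N : ℝ)⁻¹ * ∑ n ∈ Finset.Icc 1 N, g (s n) -
      (N : ℝ)⁻¹ * ∑ n ∈ Finset.Icc 1 N, φ i (s n)| ≤ ε / 3 := by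
    rw [← mul_sub, ← Finset.sum_sub_distrib, abs_mul, abs_of_nonneg (by positivity)]
    have h3 : |∑ n ∈ Finset.Icc 1 N, (g (s n) - φ i (s n))| ≤ N * (ε / 3) := by
      refine (Finset.abs_sum_le_sum_abs _ _).trans ((Finset.sum_le_sum fun n _ => hpt _).trans ?_)
      simp
    rcases Nat.eq_zero_or_pos N with rfl | hN0
    · simp; positivity
    · have : (0 : ℝ) < N := by exact_mod_cast hN0
      rw [inv_mul_le_iff₀ this]
      exact h3
  have h4 : |∫ z, φ i z ∂μ - ∫ z, g z ∂μ| ≤ ε / 3 := by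
    rw [← integral_sub (hint _) (hint _)]
    have := norm_integral_le_of_norm_le_const (μ := μ) (f := fun z => φ i z - g z)
      (ae_of_all _ fun z => by rw [Real.norm_eq_abs, abs_sub_comm]; exact hpt z)
    simpa using this
  rw [Real.dist_eq] at h1 ⊢
  rw [abs_le] at h2 h4
  rw [abs_lt] at h1 ⊢
  constructor <;> linarith [h1.1, h1.2, h2.1, h2.2, h4.1, h4.2]

/-- If the complement of the ball were null for the limit measure it would be Lebesgue null, but the
ball has volume at most `(1/4)^2`. -/
theorem limitMeasure_ball_ne_one (hk : 1 < k) (hA : MeasurableSet A) (hZ : totalMass A < ∞) :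
    (limitMeasure A).real (Metric.ball 0 (1 / 8)) ≠ 1 := by
  have := isProbabilityMeasure_limitMeasure hZ
  intro h
  have h1 : limitMeasure A (Metric.ball 0 (1 / 8))ᶜ = 0 := by
    rw [prob_compl_eq_zero_iff Metric.isOpen_ball.measurableSet]
    rwa [Measure.real, ENNReal.toReal_eq_one_iff] at h
  have h2 := volume_absolutelyContinuous_limitMeasure hA hZ h1
  rw [prob_compl_eq_zero_iff Metric.isOpen_ball.measurableSet] at h2
  have h3 := (measure_mono (μ := volume) (Metric.ball_subset_closedBall)).trans
    (volume_closedBall_le (k := k) (r := 1 / 8) (by norm_num) hk)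
  rw [h2, ← ENNReal.ofReal_pow (by norm_num), ENNReal.one_le_ofReal] at h3
  norm_num at h3

end TwoPointMotion

end DoubleRotation

theorem theorem5 (k : ℕ) (hk : 1 < k)
    (v : DoubleRotation.Torus k) (hv : DoubleRotation.RationallyIndependent v)
    (A : Set (DoubleRotation.Torus k)) (hA : MeasurableSet A)
    (hsymm : DoubleRotation.NoTranslationalSymmetries A) :
    (∃ α : ℝ, 0 < α ∧
      ∀ u : DoubleRotation.Torus k, α * dist u 0 ≤ DoubleRotation.displacement A u) ∧
    DoubleRotation.totalMass A < ⊤ ∧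
    ∃ μ : ProbabilityMeasure (DoubleRotation.Torus k),
      (μ : Measure (DoubleRotation.Torus k)) = DoubleRotation.limitMeasure A ∧
      ∀ᵐ p : DoubleRotation.Torus k × DoubleRotation.Torus k,
        ∀ᵐ w ∂(DoubleRotation.noise k),
          Tendsto (fun N : ℕ => DoubleRotation.empiricalDifference A v w p.1 p.2 N) atTop
            (𝓝 μ.toFiniteMeasure) ∧
          ¬ DoubleRotation.Synchronize A v w p.1 p.2 := by
  have hZ := DoubleRotation.totalMass_lt_top hk hA hsymm
  have hprob := DoubleRotation.isProbabilityMeasure_limitMeasure hZ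
  refine ⟨?_, hZ, ⟨DoubleRotation.limitMeasure A, hprob⟩, rfl, ?_⟩
  · simpa only [dist_zero_right] using DoubleRotation.exists_mul_norm_le_displacement hA hsymm
  -- Separability of the continuous functions leaves countably many exceptional null sets.
  set φ := TopologicalSpace.denseSeq C(DoubleRotation.Torus k, ℝ)
  have hcont := ae_all_iff.2 fun i => DoubleRotation.ae_tendsto_average_difference hk hv hA hsymm
    (φ i).continuous.measurable (φ i).norm_coe_le_norm
  -- The indicator of the ball is not among the continuous test functions, but the ergodic theorem
  -- covers bounded measurable ones, so the frequency of close encounters has a limit directly.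
  have hball := DoubleRotation.ae_tendsto_average_difference hk hv hA hsymm
    (g := (Metric.ball 0 (1 / 8)).indicator 1)
    (measurable_one.indicator Metric.isOpen_ball.measurableSet) (C := 1)
    (fun z => by simp only [Set.indicator]; split_ifs <;> simp)
  rw [integral_indicator_one Metric.isOpen_ball.measurableSet] at hball
  filter_upwards [hcont, hball] with p hp1 hp2
  filter_upwards [ae_all_iff.2 hp1, hp2] with w hw1 hw2
  constructor
  · rw [FiniteMeasure.tendsto_iff_forall_integral_tendsto]
    intro g
    have h := DoubleRotation.tendsto_average_of_denseRange (TopologicalSpace.denseRange_denseSeq _) hw1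
      g.toContinuousMap
    simp only [← DoubleRotation.integral_empiricalDifference] at h
    exact h
  · intro hsync
    refine DoubleRotation.limitMeasure_ball_ne_one hk hA hZ (tendsto_nhds_unique hw2 ?_)
    refine (hsync (1 / 8) (by norm_num)).congr fun N => ?_
    rw [div_eq_inv_mul, Finset.card_filter]
    push_cast
    congr 1
    refine Finset.sum_congr rfl fun n _ => ?_
    simp [Set.indicator, dist_eq_norm]
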